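/- Let $s\ge 1$ and let $\mathcal K$ be the set of double cones of $(s+1)$-dimensional Minkowski space, ordered by inclusion; $\mathcal O'$ denotes the spacelike complement of $\mathcal O$. A $\mathbb Z_2$-graded net $\mathfrak F$ on a complex Hilbert space $\mathcal H_{\mathfrak F}$ is an isotonous family $\mathcal O\mapsto\mathfrak F(\mathcal O)$, $\mathcal O\in\mathcal K$, of von Neumann algebras on $\mathcal H_{\mathfrak F}$ together with a unitary $k=k_{\mathfrak F}$ on $\mathcal H_{\mathfrak F}$ with $k^2=1$ and $k\,\mathfrak F(\mathcal O)\,k=\mathfrak F(\mathcal O)$ for all $\mathcal O$. Put $\mathfrak F_\pm(\mathcal O)=\{A\in\mathfrak F(\mathcal O): kAk=\pm A\}$ and $\mathfrak F^t(\mathcal O)=\mathfrak F_+(\mathcal O)+ik\,\mathfrak F_-(\mathcal O)$. The twisted dual net $\mathfrak F^d$ is the $\mathbb Z_2$-graded net on $\mathcal H_{\mathfrak F}$, with the same $k$, given by $\mathfrak F^d(\mathcal O)=\bigcap_{\mathcal O_1\subset\mathcal O'}\mathfrak F^t(\mathcal O_1)'$. A net morphism is a family of unital $*$-homomorphisms between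 the algebras of two nets, one for each $\mathcal O\in\mathcal K$, compatible with the inclusions $\mathcal O_1\subset\mathcal O_2$. Let $\mathfrak B\subset\mathfrak F$ be an inclusion of $\mathbb Z_2$-graded nets: a net morphism $\mathfrak B\to\mathfrak F$ consisting of injective normal $*$-homomorphisms, together with an inclusion of Hilbert spaces $\mathcal H_{\mathfrak B}\subset\mathcal H_{\mathfrak F}$, such that for each $\mathcal O$ the image in $\mathfrak F(\mathcal O)$ of any $B\in\mathfrak B(\mathcal O)$ agrees with $B$ on $\mathcal H_{\mathfrak B}$, such that $k_{\mathfrak B}$ is the restriction of $k_{\mathfrak F}$, and such that $\mathcal H_{\mathfrak B}$ is cyclic and separating for each $\mathfrak F(\mathcal O)$. Let $E$ be the orthogonal projection of $\mathcal H_{\mathfrak F}$ onto $\mathcal H_{\mathfrak B}$, and let $\mathfrak F^d{}_E(\mathcal O)$ be the set of restrictions to $\mathcal H_{\mathfrak B}$ of the elements of $\mathfrak F^d(\mathcal O)$ that commute with $E$. Then the following are equivalent: a) there is a net morphism $\nu:\mathfrak B^d\to\mathfrak F^d$ such that $\nu(B)\Phi=B\Phi$ for all $\mathcal O\in\mathcal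 K$, $B\in\mathfrak B^d(\mathcal O)$, $\Phi\in\mathcal H_{\mathfrak B}$; b) $\mathfrak B^d(\mathcal O)=\mathfrak F^d{}_E(\mathcal O)$ for all $\mathcal O\in\mathcal K$. A morphism $\nu$ as in a) is necessarily unique, injective, normal and $\mathbb Z_2$-graded, i.e. $\nu(k_{\mathfrak B}Bk_{\mathfrak B})=k_{\mathfrak F}\nu(B)k_{\mathfrak F}$. If the conditions are fulfilled, there is a unique normal conditional expectation $m$ of nets of $\mathfrak F^d$ onto $\nu(\mathfrak B^d)$, that is, a unique family of normal conditional expectations $m_{\mathcal O}$ of $\mathfrak F^d(\mathcal O)$ onto $\nu(\mathfrak B^d(\mathcal O))$, $\mathcal O\in\mathcal K$, compatible with the inclusions $\mathcal O_1\subset\mathcal O_2$, such that $$m(F)E=EFE,\qquad F\in\mathfrak F^d(\mathcal O),\ \mathcal O\in\mathcal K.$$ -/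

import Mathlib

noncomputable section

namespace GradedNets

/-- Minkowski space with one time and `s` space dimensions; a point is `(t, x)`. -/
abbrev Minkowski (s : ℕ) : Type := ℝ × EuclideanSpace ℝ (Fin s)

/-- The open forward light cone. -/
def forwardCone (s : ℕ) : Set (Minkowski s) := {p | ‖p.2‖ < p.1}

/-- The open double cone with past apex `a` and future apex `b`. -/
def doubleConeSet {s : ℕ} (a b : Minkowski s) : Set (Minkowski s) :=
  {p | p - a ∈ forwardCone s ∧ b - p ∈ forwardCone s}

/-- The double cones of Minkowski space, ordered by inclusion. -/
abbrev DoubleCone (s : ℕ) : Type :=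
  {O : Set (Minkowski s) // ∃ a b : Minkowski s, b - a ∈ forwardCone s ∧ O = doubleConeSet a b}

/-- The spacelike complement: all points that are spacelike to every point of `O`. -/
def spacelikeComplement {s : ℕ} (O : Set (Minkowski s)) : Set (Minkowski s) :=
  {p | ∀ q ∈ O, |p.1 - q.1| < ‖p.2 - q.2‖}

/-- A concrete `ℤ₂`-graded net of von Neumann algebras over the double cones: an isotonous
family of von Neumann algebras on `H` with an involutive unitary `k` on `H` that induces an
automorphism of each of the algebras. No commutation relations are assumed. -/
structure GradedNet (s : ℕ) (H : Type*) [NormedAddCommGroup H] [InnerProductSpace ℂ H]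
    [CompleteSpace H] where
  alg : DoubleCone s → VonNeumannAlgebra H
  mono : ∀ ⦃O₁ O₂ : DoubleCone s⦄, O₁ ≤ O₂ → ∀ ⦃A : H →L[ℂ] H⦄, A ∈ alg O₁ → A ∈ alg O₂
  k : H →L[ℂ] H
  k_unitary : k ∈ unitary (H →L[ℂ] H)
  k_mul_k : k * k = 1
  k_conj : ∀ (O : DoubleCone s) (A : H →L[ℂ] H), A ∈ alg O → k * A * k ∈ alg O

namespace GradedNet

variable {s : ℕ} {H : Type*} [NormedAddCommGroup H] [InnerProductSpace ℂ H] [CompleteSpace H]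

/-- The algebra of a double cone, as a star algebra. -/
abbrev Alg (F : GradedNet s H) (O : DoubleCone s) : Type _ := ↥((F.alg O).toStarSubalgebra)

/-- The even (Bose) part. -/
def even (F : GradedNet s H) (O : DoubleCone s) : Set (H →L[ℂ] H) :=
  {A | A ∈ F.alg O ∧ F.k * A * F.k = A}

/-- The odd (Fermi) part. -/
def odd (F : GradedNet s H) (O : DoubleCone s) : Set (H →L[ℂ] H) :=
  {A | A ∈ F.alg O ∧ F.k * A * F.k = -A}

/-- The algebra of the twisted net, even part plus `i k` times odd part. -/
def twisted (F : GradedNet s H) (O : DoubleCone s) : Set (H →L[ℂ] H) :=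
  {T | ∃ A ∈ F.even O, ∃ C ∈ F.odd O, T = A + Complex.I • (F.k * C)}

theorem star_k (F : GradedNet s H) : star F.k = F.k := by
  have h := (Unitary.mem_iff.1 F.k_unitary).1
  calc star F.k = star F.k * (F.k * F.k) := by rw [F.k_mul_k, mul_one]
    _ = F.k := by rw [← mul_assoc, h, one_mul]

theorem odd_anticomm (F : GradedNet s H) {O : DoubleCone s} {C : H →L[ℂ] H} (hC : C ∈ F.odd O) :
    C * F.k = -(F.k * C) := by
  have h : F.k * (F.k * C * F.k) = F.k * (-C) := by rw [hC.2]
  rwa [mul_assoc F.k C, ← mul_assoc F.k F.k, F.k_mul_k, one_mul, mul_neg] at h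

theorem star_mem_twisted (F : GradedNet s H) {O : DoubleCone s} {T : H →L[ℂ] H}
    (hT : T ∈ F.twisted O) : star T ∈ F.twisted O := by
  obtain ⟨A, hA, C, hC, rfl⟩ := hT
  have hC' : star C ∈ F.odd O := by
    refine ⟨star_mem hC.1, ?_⟩
    have := congrArg star hC.2
    simpa [star_mul, F.star_k, mul_assoc] using this
  refine ⟨star A, ⟨star_mem hA.1, ?_⟩, star C, hC', ?_⟩
  · have := congrArg star hA.2
    simpa [star_mul, F.star_k, mul_assoc] using this
  · rw [star_add, star_smul, star_mul, F.star_k, F.odd_anticomm hC']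
    simp

theorem k_conj_mem_twisted (F : GradedNet s H) {O : DoubleCone s} {T : H →L[ℂ] H}
    (hT : T ∈ F.twisted O) : F.k * T * F.k ∈ F.twisted O := by
  obtain ⟨A, hA, C, hC, rfl⟩ := hT
  have hC' : -C ∈ F.odd O := ⟨neg_mem hC.1, by rw [mul_neg, neg_mul, hC.2]⟩
  refine ⟨A, hA, -C, hC', ?_⟩
  rw [mul_add, add_mul, hA.2, mul_smul_comm, smul_mul_assoc, ← hC.2]
  simp only [mul_assoc]

/-- All operators in the twisted algebras of the double cones spacelike to `O`. -/
def twistedSpacelike (F : GradedNet s H) (O : DoubleCone s) : Set (H →L[ℂ] H) :=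
  {T | ∃ O₁ : DoubleCone s, (O₁ : Set (Minkowski s)) ⊆ spacelikeComplement (O : Set _) ∧
    T ∈ F.twisted O₁}

/-- The twisted dual net: the algebra of `O` is the intersection, over the double cones `O₁`
spacelike to `O`, of the commutants of the twisted algebras of `O₁`; the unitary is the same. -/
def dual (F : GradedNet s H) : GradedNet s H where
  alg O :=
    { carrier := Set.centralizer (F.twistedSpacelike O)
      mul_mem' := fun ha hb => Set.mul_mem_centralizer ha hb
      one_mem' := Set.one_mem_centralizer
      add_mem' := fun ha hb => Set.add_mem_centralizer ha hb
      zero_mem' := Set.zero_mem_centralizer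
      algebraMap_mem' := fun r T _ => (Algebra.commutes r T).symm
      star_mem' := fun ha => Set.star_mem_centralizer'
        (fun _ ⟨O₁, h₁, hT⟩ => ⟨O₁, h₁, F.star_mem_twisted hT⟩) ha
      centralizer_centralizer' := Set.centralizer_centralizer_centralizer _ }
  mono := by
    rintro O₁ O₂ h A hA T ⟨O, hO, hT⟩
    exact hA T ⟨O, fun p hp q hq => hO hp q (h hq), hT⟩
  k := F.k
  k_unitary := F.k_unitary
  k_mul_k := F.k_mul_k
  k_conj := by
    rintro O A hA T ⟨O₁, h₁, hT⟩
    have h : (F.k * T * F.k) * A = A * (F.k * T * F.k) := hA _ ⟨O₁, h₁, F.k_conj_mem_twisted hT⟩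
    have h2 := congrArg (fun X => F.k * X * F.k) h
    have e : ∀ X : H →L[ℂ] H, F.k * (F.k * X) = X := fun X => by
      rw [← mul_assoc, F.k_mul_k, one_mul]
    simpa only [mul_assoc, e, F.k_mul_k, mul_one] using h2

theorem mem_dual_alg_iff (F : GradedNet s H) (O : DoubleCone s) (A : H →L[ℂ] H) :
    A ∈ F.dual.alg O ↔ ∀ O₁ : DoubleCone s,
      (O₁ : Set (Minkowski s)) ⊆ spacelikeComplement (O : Set _) →
        ∀ T ∈ F.twisted O₁, T * A = A * T :=
  ⟨fun h O₁ h₁ T hT => h T ⟨O₁, h₁, hT⟩, fun h T ⟨O₁, h₁, hT⟩ => h O₁ h₁ T hT⟩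

end GradedNet

section Maps

variable {s : ℕ} {K H : Type*}
  [NormedAddCommGroup K] [InnerProductSpace ℂ K] [CompleteSpace K]
  [NormedAddCommGroup H] [InnerProductSpace ℂ H] [CompleteSpace H]

/-- A map between von Neumann algebras is normal if it preserves the least upper bounds of
bounded increasing families of self-adjoint elements. -/
def IsNormalMap {M : VonNeumannAlgebra K} {N : VonNeumannAlgebra H}
    (f : ↥M.toStarSubalgebra → ↥N.toStarSubalgebra) : Prop :=
  ∀ D : Set ↥M.toStarSubalgebra, D.Nonempty → (∀ x ∈ D, IsSelfAdjoint x) →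
    DirectedOn (· ≤ ·) D → ∀ a, IsLUB D a → IsLUB (f '' D) (f a)

/-- A net morphism: a family of unital star homomorphisms compatible with isotony. -/
@[ext]
structure NetMorphism (B : GradedNet s K) (F : GradedNet s H) where
  map : ∀ O : DoubleCone s, B.Alg O →⋆ₐ[ℂ] F.Alg O
  compat : ∀ ⦃O₁ O₂ : DoubleCone s⦄ (h : O₁ ≤ O₂) (A : B.Alg O₁),
    (map O₂ ⟨A, B.mono h A.2⟩ : H →L[ℂ] H) = map O₁ A

/-- An inclusion of `ℤ₂`-graded nets: compatible normal inclusions of the algebras, and an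
inclusion `V` of the Hilbert spaces, compatible with the former and with the unitaries, whose
range is cyclic and separating for each algebra of the larger net. -/
structure NetInclusion (B : GradedNet s K) (F : GradedNet s H) where
  ι : NetMorphism B F
  ι_injective : ∀ O, Function.Injective (ι.map O)
  ι_normal : ∀ O, IsNormalMap (ι.map O)
  V : K →ₗᵢ[ℂ] H
  ι_apply_V : ∀ (O : DoubleCone s) (A : B.Alg O) (Φ : K),
    (ι.map O A : H →L[ℂ] H) (V Φ) = V ((A : K →L[ℂ] K) Φ)
  V_k : ∀ Φ : K, V (B.k Φ) = F.k (V Φ)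
  cyclic : ∀ O : DoubleCone s,
    (Submodule.span ℂ {x : H | ∃ A ∈ F.alg O, ∃ Φ : K, x = A (V Φ)}).topologicalClosure = ⊤
  separating : ∀ (O : DoubleCone s), ∀ A ∈ F.alg O, (∀ Φ : K, A (V Φ) = 0) → A = 0

/-- The orthogonal projection `V V*` of the larger Hilbert space onto the range of `V`. -/
def NetInclusion.E {B : GradedNet s K} {F : GradedNet s H} (i : NetInclusion B F) : H →L[ℂ] H :=
  i.V.toContinuousLinearMap ∘L ContinuousLinearMap.adjoint i.V.toContinuousLinearMap

/-- The restriction to the smaller Hilbert space of the operators in `G(O)` that commute with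
the projection `E`, for a net `G` on the larger Hilbert space. -/
def NetInclusion.restrict {B : GradedNet s K} {F : GradedNet s H} (i : NetInclusion B F)
    (G : GradedNet s H) (O : DoubleCone s) : Set (K →L[ℂ] K) :=
  {A | ∃ X ∈ G.alg O, X * i.E = i.E * X ∧ ∀ Φ : K, X (i.V Φ) = i.V (A Φ)}

/-- A conditional expectation of `M` onto a star subalgebra `N` of `M`: a positive linear
contraction of `M` with range `N` that is the identity on `N` and an `N`-bimodule map. -/
structure IsCondExp {M : VonNeumannAlgebra H} (N : StarSubalgebra ℂ ↥M.toStarSubalgebra)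
    (m : ↥M.toStarSubalgebra →ₗ[ℂ] ↥M.toStarSubalgebra) : Prop where
  range_eq : Set.range m = (N : Set ↥M.toStarSubalgebra)
  map_of_mem : ∀ x ∈ N, m x = x
  nonneg : ∀ x, 0 ≤ x → 0 ≤ m x
  norm_le : ∀ x, ‖m x‖ ≤ ‖x‖
  bimodule : ∀ a ∈ N, ∀ b ∈ N, ∀ x, m (a * x * b) = a * m x * b

/-- A conditional expectation of nets, of `F` onto the net of subalgebras `N`. -/
structure IsNetCondExp (F : GradedNet s H) (N : ∀ O, StarSubalgebra ℂ (F.Alg O))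
    (m : ∀ O, F.Alg O →ₗ[ℂ] F.Alg O) : Prop where
  condExp : ∀ O, IsCondExp (N O) (m O)
  compat : ∀ ⦃O₁ O₂ : DoubleCone s⦄ (h : O₁ ≤ O₂) (A : F.Alg O₁),
    (m O₂ ⟨A, F.mono h A.2⟩ : H →L[ℂ] H) = m O₁ A

end Maps

end GradedNets

end

/-!
The range of `V` is cyclic for the twisted algebra of a double cone spacelike to `O`, hence
separating for `𝔉ᵈ(O)`. An operator in `𝔉ᵈ(O)` is therefore determined by its action on the range
of `V`, which makes operators in `𝔉ᵈ(O)` that extend `A` and `A*` automatically depend on `A`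
multiplicatively, linearly and compatibly with isotony. Since the twisted algebras of `𝔅` extend to
those of `𝔉`, the compression `X ↦ V* X V` maps `𝔉ᵈ(O)` into `𝔅ᵈ(O)`, and `m(X) = ν(V* X V)` is the
conditional expectation. Both `ν` and `m` are normal because a bounded increasing family converges
strongly to its least upper bound, and the limit is again detected on the range of `V`.
-/

noncomputable section

open Filter Topology
open scoped ComplexOrder InnerProduct InnerProductSpace

namespace GradedNets

section StrongLimits

theorem cauchySeq_of_forall_exists_dist_lt {ι X : Type*} [Preorder ι] [IsDirectedOrder ι]
    [Nonempty ι] [PseudoMetricSpace X] {u : ι → X}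
    (hu : ∀ ε > 0, ∃ j, ∀ k ≥ j, dist (u k) (u j) < ε) : CauchySeq u := by
  refine Metric.cauchy_iff.2 ⟨inferInstance, fun ε hε => ?_⟩
  obtain ⟨j, hj⟩ := hu (ε / 2) (half_pos hε)
  refine ⟨u '' Set.Ici j, image_mem_map (Ici_mem_atTop j), ?_⟩
  rintro _ ⟨k, hk, rfl⟩ _ ⟨l, hl, rfl⟩
  linarith [hj k hk, hj l hl, dist_triangle_right (u k) (u l) (u j)]

variable {H ι : Type*} [NormedAddCommGroup H] [InnerProductSpace ℂ H]

theorem le_iff_forall_inner_le (S T : H →L[ℂ] H) :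
    S ≤ T ↔ ∀ x, ⟪S x, x⟫_ℂ ≤ ⟪T x, x⟫_ℂ := by
  rw [ContinuousLinearMap.le_def, ContinuousLinearMap.isPositive_iff_complex]
  refine forall_congr' fun x => ?_
  rw [← sub_nonneg (a := ⟪T x, x⟫_ℂ), ← inner_sub_left, Complex.nonneg_iff, Complex.ext_iff]
  simp [and_comm]

theorem le_of_tendsto_apply {l : Filter ι} [l.NeBot] {S T : ι → H →L[ℂ] H} {A C : H →L[ℂ] H}
    (hS : ∀ x, Tendsto (fun j => S j x) l (𝓝 (A x)))
    (hT : ∀ x, Tendsto (fun j => T j x) l (𝓝 (C x))) (hST : ∀ᶠ j in l, S j ≤ T j) : A ≤ C := by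
  refine (le_iff_forall_inner_le A C).2 fun x => ?_
  refine le_of_tendsto_of_tendsto ((hS x).inner tendsto_const_nhds)
    ((hT x).inner tendsto_const_nhds) ?_
  filter_upwards [hST] with j hj using (le_iff_forall_inner_le _ _).1 hj x

theorem re_inner_apply_mono {S T : H →L[ℂ] H} (h : S ≤ T) (x : H) :
    RCLike.re ⟪S x, x⟫_ℂ ≤ RCLike.re ⟪T x, x⟫_ℂ :=
  (RCLike.le_iff_re_im.1 ((le_iff_forall_inner_le S T).1 h x)).1

variable [CompleteSpace H]

theorem norm_apply_sq_le_of_nonneg {P : H →L[ℂ] H} (hP : 0 ≤ P) (x : H) :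
    ‖P x‖ ^ 2 ≤ ‖P‖ * RCLike.re ⟪P x, x⟫_ℂ := by
  set S := CFC.sqrt P
  have hS : star S = S := (CFC.sqrt_nonneg P).isSelfAdjoint
  have hSS : S * S = P := CFC.sqrt_mul_sqrt_self P
  have hnorm : ‖S‖ ^ 2 = ‖P‖ := by
    rw [sq, ← CStarRing.norm_star_mul_self, hS, hSS]
  have hinner : ‖S x‖ ^ 2 = RCLike.re ⟪P x, x⟫_ℂ := by
    rw [S.apply_norm_sq_eq_inner_adjoint_left, ← ContinuousLinearMap.star_eq_adjoint, hS, ← hSS]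
    rfl
  calc ‖P x‖ ^ 2 = ‖S (S x)‖ ^ 2 := by rw [← hSS]; rfl
    _ ≤ (‖S‖ * ‖S x‖) ^ 2 := by gcongr; exact S.le_opNorm _
    _ = ‖P‖ * RCLike.re ⟪P x, x⟫_ℂ := by rw [mul_pow, hnorm, hinner]

theorem norm_sub_apply_sq_le {R S T b : H →L[ℂ] H} (hRS : R ≤ S) (hST : S ≤ T) (hTb : T ≤ b)
    (x : H) : ‖T x - S x‖ ^ 2 ≤ ‖b - R‖ * (RCLike.re ⟪T x, x⟫_ℂ - RCLike.re ⟪S x, x⟫_ℂ) := by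
  have hnonneg : 0 ≤ T - S := sub_nonneg.2 hST
  have hle : T - S ≤ b - R := sub_le_sub hTb hRS
  calc ‖T x - S x‖ ^ 2 ≤ ‖T - S‖ * RCLike.re ⟪(T - S) x, x⟫_ℂ :=
        norm_apply_sq_le_of_nonneg hnonneg x
    _ = ‖T - S‖ * (RCLike.re ⟪T x, x⟫_ℂ - RCLike.re ⟪S x, x⟫_ℂ) := by
        rw [sub_apply, inner_sub_left, map_sub]
    _ ≤ ‖b - R‖ * (RCLike.re ⟪T x, x⟫_ℂ - RCLike.re ⟪S x, x⟫_ℂ) := by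
        gcongr
        · exact sub_nonneg.2 (re_inner_apply_mono hST x)
        · exact CStarAlgebra.norm_le_norm_of_nonneg_of_le hnonneg hle

variable [Preorder ι] [IsDirectedOrder ι] [Nonempty ι] {T : ι → H →L[ℂ] H} {b : H →L[ℂ] H}

theorem cauchySeq_apply_of_monotone (hT : Monotone T) (hb : ∀ j, T j ≤ b) (x : H) :
    CauchySeq fun j => T j x := by
  obtain ⟨j₀⟩ := ‹Nonempty ι›
  let q : ι → ℝ := fun j => RCLike.re ⟪T j x, x⟫_ℂ
  have hq : Monotone q := fun j k h => re_inner_apply_mono (hT h) x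
  have hq_bdd : BddAbove (Set.range q) :=
    ⟨RCLike.re ⟪b x, x⟫_ℂ, Set.forall_mem_range.2 fun j => re_inner_apply_mono (hb j) x⟩
  have hdiff {j k : ι} (hj : j₀ ≤ j) (hjk : j ≤ k) :
      ‖T k x - T j x‖ ^ 2 ≤ ‖b - T j₀‖ * ((⨆ i, q i) - q j) := by
    refine (norm_sub_apply_sq_le (hT hj) (hT hjk) (hb k) x).trans ?_
    gcongr
    exact le_ciSup hq_bdd k
  have hlim : Tendsto (fun j => ‖b - T j₀‖ * ((⨆ i, q i) - q j)) atTop (𝓝 0) := by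
    simpa using ((tendsto_atTop_ciSup hq hq_bdd).const_sub (⨆ i, q i)).const_mul ‖b - T j₀‖
  refine cauchySeq_of_forall_exists_dist_lt fun ε hε => ?_
  obtain ⟨j, hj, hjε⟩ :=
    ((eventually_ge_atTop j₀).and (hlim.eventually_lt_const (pow_pos hε 2))).exists
  refine ⟨j, fun k hk => ?_⟩
  rw [dist_eq_norm]
  exact lt_of_pow_lt_pow_left₀ 2 hε.le ((hdiff hj hk).trans_lt hjε)

theorem exists_tendsto_apply_of_monotone (hT : Monotone T) (hb : ∀ j, T j ≤ b) :
    ∃ A : H →L[ℂ] H, ∀ x, Tendsto (fun j => T j x) atTop (𝓝 (A x)) := by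
  choose A hA using fun x => cauchySeq_tendsto_of_complete (cauchySeq_apply_of_monotone hT hb x)
  obtain ⟨j₀⟩ := ‹Nonempty ι›
  have hbounded : Bornology.IsBounded (Set.Icc (T j₀) b) := by
    refine isBounded_iff_forall_norm_le.2 ⟨‖b - T j₀‖ + ‖T j₀‖, fun S hS => ?_⟩
    have := CStarAlgebra.norm_le_norm_of_nonneg_of_le (sub_nonneg.2 hS.1)
      (sub_le_sub_right hS.2 (T j₀))
    exact (norm_le_norm_sub_add S (T j₀)).trans (by gcongr)
  refine ⟨ContinuousLinearMap.ofMemClosureImageCoeBounded A hbounded ?_, hA⟩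
  refine mem_closure_of_tendsto (tendsto_pi_nhds.2 hA) ?_
  filter_upwards [eventually_ge_atTop j₀] with j hj
  exact Set.mem_image_of_mem _ ⟨hT hj, hb j⟩

end StrongLimits

section StarSubalgebra

scoped instance instStarOrderedRingStarSubalgebra {A : Type*} [CStarAlgebra A] [PartialOrder A]
    [StarOrderedRing A] (S : StarSubalgebra ℂ A) [IsClosed (S : Set A)] : StarOrderedRing S := by
  refine StarOrderedRing.of_nonneg_iff' (fun {x y} h z => ?_) fun x => ⟨fun hx => ?_, ?_⟩
  · exact add_le_add_right (show (x : A) ≤ y from h) (z : A)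
  · have hx' : 0 ≤ (x : A) := hx
    have hmem : CFC.sqrt (x : A) ∈ S := by
      rw [CFC.sqrt_eq_real_sqrt (x : A)]
      exact cfcₙ_mem (𝕜' := ℂ) Real.sqrt x.2
    refine ⟨⟨CFC.sqrt (x : A), hmem⟩, Subtype.ext ?_⟩
    change (x : A) = star (CFC.sqrt (x : A)) * CFC.sqrt (x : A)
    rw [(CFC.sqrt_nonneg (x : A)).isSelfAdjoint.star_eq, CFC.sqrt_mul_sqrt_self (x : A)]
  · rintro ⟨y, rfl⟩
    exact star_mul_self_nonneg (y : A)

end StarSubalgebra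

section VonNeumannAlgebra

variable {K H L : Type*}
  [NormedAddCommGroup K] [InnerProductSpace ℂ K] [CompleteSpace K]
  [NormedAddCommGroup H] [InnerProductSpace ℂ H] [CompleteSpace H]

scoped instance isClosed_toStarSubalgebra (M : VonNeumannAlgebra H) :
    IsClosed (M.toStarSubalgebra : Set (H →L[ℂ] H)) := by
  rw [M.coe_toStarSubalgebra, ← M.centralizer_centralizer]
  exact Set.isClosed_centralizer _

theorem mem_of_tendsto_apply (M : VonNeumannAlgebra H) {l : Filter L} [l.NeBot]
    {T : L → H →L[ℂ] H} {A : H →L[ℂ] H} (hT : ∀ j, T j ∈ M)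
    (hA : ∀ x, Tendsto (fun j => T j x) l (𝓝 (A x))) : A ∈ M := by
  rw [← M.commutant_commutant, VonNeumannAlgebra.mem_commutant_iff]
  intro S hS
  ext x
  refine tendsto_nhds_unique (((S.continuous.tendsto _).comp (hA x)).congr fun j => ?_) (hA (S x))
  exact (DFunLike.congr_fun (VonNeumannAlgebra.mem_commutant_iff.1 hS (T j) (hT j)) x).symm

theorem tendsto_apply_of_isLUB {M : VonNeumannAlgebra H} {D : Set M.toStarSubalgebra}
    (hne : D.Nonempty) (hdir : DirectedOn (· ≤ ·) D) {a : M.toStarSubalgebra} (ha : IsLUB D a)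
    (x : H) : Tendsto (fun d : D => (d : H →L[ℂ] H) x) atTop (𝓝 ((a : H →L[ℂ] H) x)) := by
  have : Nonempty D := hne.to_subtype
  have : IsDirectedOrder D := ⟨directedOn_iff_directed.1 hdir⟩
  obtain ⟨A, hA⟩ := exists_tendsto_apply_of_monotone (T := fun d : D => (d : H →L[ℂ] H))
    (fun _ _ h => h) fun d => ha.1 d.2
  have hAM : A ∈ M := mem_of_tendsto_apply M (fun d : D => d.1.2) hA
  have hlub : IsLUB D (⟨A, hAM⟩ : M.toStarSubalgebra) :=
    ⟨fun d hd => le_of_tendsto_apply (fun _ => tendsto_const_nhds) hA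
        (eventually_ge_atTop (⟨d, hd⟩ : D)),
      fun u hu => le_of_tendsto_apply hA (fun _ => tendsto_const_nhds)
        (Eventually.of_forall fun d => hu d.2)⟩
  rw [ha.unique hlub]
  exact hA x

end VonNeumannAlgebra

section Separating

variable {𝕜 H L : Type*} [RCLike 𝕜] [NormedAddCommGroup H] [InnerProductSpace 𝕜 H]
  [CompleteSpace H]

/-- The range of `W` is separating for the algebra `S` of operators. -/
def IsSeparating (S : StarSubalgebra 𝕜 (H →L[𝕜] H)) (W : L → H) : Prop :=
  ∀ X ∈ S, (∀ Φ, X (W Φ) = 0) → X = 0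

theorem IsSeparating.eq {S : StarSubalgebra 𝕜 (H →L[𝕜] H)} {W : L → H} (hW : IsSeparating S W)
    {X Y : H →L[𝕜] H} (hX : X ∈ S) (hY : Y ∈ S) (h : ∀ Φ, X (W Φ) = Y (W Φ)) : X = Y :=
  sub_eq_zero.1 (hW _ (sub_mem hX hY) fun Φ => by rw [sub_apply, h, sub_self])

end Separating

section Normal

variable {K H L : Type*}
  [NormedAddCommGroup K] [InnerProductSpace ℂ K] [CompleteSpace K]
  [NormedAddCommGroup H] [InnerProductSpace ℂ H] [CompleteSpace H]

theorem isNormalMap_of_monotone {M : VonNeumannAlgebra K} {N : VonNeumannAlgebra H}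
    {f : M.toStarSubalgebra → N.toStarSubalgebra} (hf : Monotone f) {W : L → H}
    (hW : IsSeparating N.toStarSubalgebra W) (S : K →L[ℂ] H) (T : L → K)
    (hfW : ∀ x Φ, (f x : H →L[ℂ] H) (W Φ) = S ((x : K →L[ℂ] K) (T Φ))) : IsNormalMap f := by
  intro D hne _ hdir a ha
  have : Nonempty D := hne.to_subtype
  have : IsDirectedOrder D := ⟨directedOn_iff_directed.1 hdir⟩
  obtain ⟨C, hC⟩ := exists_tendsto_apply_of_monotone (T := fun d : D => (f d : H →L[ℂ] H))
    (fun _ _ h => hf h) fun d => hf (ha.1 d.2)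
  have hCN : C ∈ N := mem_of_tendsto_apply N (fun d : D => (f d).2) hC
  have hCa : C = f a := hW.eq hCN (f a).2 fun Φ => by
    refine tendsto_nhds_unique (hC (W Φ)) ?_
    simp only [hfW]
    exact (S.continuous.tendsto _).comp (tendsto_apply_of_isLUB hne hdir ha (T Φ))
  refine ⟨hf.mem_upperBounds_image ha.1, fun u hu => ?_⟩
  exact le_of_tendsto_apply (hCa ▸ hC) (fun _ => tendsto_const_nhds)
    (Eventually.of_forall fun d => hu (Set.mem_image_of_mem f d.2))

end Normal

section Intertwiners

variable {𝕜 K H : Type*} [RCLike 𝕜]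
  [NormedAddCommGroup K] [InnerProductSpace 𝕜 K] [CompleteSpace K]
  [NormedAddCommGroup H] [InnerProductSpace 𝕜 H] [CompleteSpace H]

/-- `X` and its adjoint act on the range of `V` as `A` and its adjoint. For isometric `V` this
says that the range of `V` reduces `X`, with part `A`. -/
structure StarIntertwines (V : K →L[𝕜] H) (A : K →L[𝕜] K) (X : H →L[𝕜] H) : Prop where
  apply : ∀ Φ, X (V Φ) = V (A Φ)
  star_apply : ∀ Φ, star X (V Φ) = V (star A Φ)

namespace StarIntertwines

variable {V : K →L[𝕜] H} {A C : K →L[𝕜] K} {X Y : H →L[𝕜] H}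

theorem add (h : StarIntertwines V A X) (h' : StarIntertwines V C Y) :
    StarIntertwines V (A + C) (X + Y) where
  apply Φ := by simp [h.apply, h'.apply]
  star_apply Φ := by simp [h.star_apply, h'.star_apply]

theorem smul (r : 𝕜) (h : StarIntertwines V A X) : StarIntertwines V (r • A) (r • X) where
  apply Φ := by simp [h.apply]
  star_apply Φ := by simp [h.star_apply]

theorem mul (h : StarIntertwines V A X) (h' : StarIntertwines V C Y) :
    StarIntertwines V (A * C) (X * Y) where
  apply Φ := by simp [h.apply, h'.apply]
  star_apply Φ := by simp [h.star_apply, h'.star_apply]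

theorem adjoint_apply (h : StarIntertwines V A X) (x : H) : (V†) (X x) = A ((V†) x) := by
  refine ext_inner_right 𝕜 fun Φ => ?_
  calc ⟪(V†) (X x), Φ⟫_𝕜 = ⟪x, star X (V Φ)⟫_𝕜 := by
        rw [ContinuousLinearMap.adjoint_inner_left, ContinuousLinearMap.star_eq_adjoint,
          ContinuousLinearMap.adjoint_inner_right]
    _ = ⟪x, V (star A Φ)⟫_𝕜 := by rw [h.star_apply]
    _ = ⟪A ((V†) x), Φ⟫_𝕜 := by
        rw [← ContinuousLinearMap.adjoint_inner_left, ContinuousLinearMap.star_eq_adjoint,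
          ContinuousLinearMap.adjoint_inner_right]

theorem commute (h : StarIntertwines V A X) : Commute X (V ∘L V†) := by
  ext x
  exact (h.apply ((V†) x)).trans (congrArg V (h.adjoint_apply x)).symm

end StarIntertwines

theorem apply_adjoint_apply {V : K →L[𝕜] H} (hV : V† ∘L V = 1) (Φ : K) : (V†) (V Φ) = Φ :=
  DFunLike.congr_fun hV Φ

theorem starIntertwines_of_commute {V : K →L[𝕜] H} (hV : V† ∘L V = 1) {A : K →L[𝕜] K}
    {X : H →L[𝕜] H} (hX : Commute X (V ∘L V†)) (h : ∀ Φ, X (V Φ) = V (A Φ)) :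
    StarIntertwines V A X := by
  have hstar : V† ∘L star X = star A ∘L V† := by
    have hXV : X ∘L V = V ∘L A := ContinuousLinearMap.ext h
    simpa only [ContinuousLinearMap.adjoint_comp, ContinuousLinearMap.star_eq_adjoint]
      using congrArg (·†) hXV
  have hcomm : Commute (star X) (V ∘L V†) := by
    have := hX.star_star
    rwa [ContinuousLinearMap.star_eq_adjoint (V ∘L V†), ContinuousLinearMap.adjoint_comp,
      ContinuousLinearMap.adjoint_adjoint] at this
  refine ⟨h, fun Φ => ?_⟩
  calc star X (V Φ) = star X ((V ∘L V†) (V Φ)) := by simp [apply_adjoint_apply hV]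
    _ = V ((V†) (star X (V Φ))) := DFunLike.congr_fun hcomm.eq (V Φ)
    _ = V (star A ((V†) (V Φ))) := congrArg V (DFunLike.congr_fun hstar (V Φ))
    _ = V (star A Φ) := by rw [apply_adjoint_apply hV]

/-- The compression `V* X V` of the operator `X` along `V`. -/
def compression (V : K →L[𝕜] H) : (H →L[𝕜] H) →ₗ[𝕜] (K →L[𝕜] K) where
  toFun X := V† ∘L X ∘L V
  map_add' X Y := by ext; simp
  map_smul' r X := by ext; simp

theorem compression_apply (V : K →L[𝕜] H) (X : H →L[𝕜] H) (Φ : K) :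
    compression V X Φ = (V†) (X (V Φ)) := rfl

theorem compression_nonneg (V : K →L[𝕜] H) {X : H →L[𝕜] H} (hX : 0 ≤ X) :
    0 ≤ compression V X := by
  rw [ContinuousLinearMap.nonneg_iff_isPositive] at hX ⊢
  exact hX.adjoint_conj V

theorem compression_eq {V : K →L[𝕜] H} (hV : V† ∘L V = 1) {A : K →L[𝕜] K} {X : H →L[𝕜] H}
    (h : ∀ Φ, X (V Φ) = V (A Φ)) : compression V X = A := by
  ext Φ
  rw [compression_apply, h, apply_adjoint_apply hV]

theorem norm_compression_le {V : K →L[𝕜] H} (hV : V† ∘L V = 1) (X : H →L[𝕜] H) :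
    ‖compression V X‖ ≤ ‖X‖ := by
  have hV' : ‖V‖ ≤ 1 := by
    refine abs_le_one_iff_mul_self_le_one.2 ?_ |> (le_abs_self ‖V‖).trans
    rw [← V.norm_adjoint_comp_self, hV]
    exact ContinuousLinearMap.norm_id_le
  calc ‖V† ∘L X ∘L V‖ ≤ ‖V†‖ * (‖X‖ * ‖V‖) :=
        (ContinuousLinearMap.opNorm_comp_le _ _).trans (by gcongr; exact X.opNorm_comp_le V)
    _ ≤ 1 * (‖X‖ * 1) := by
        gcongr
        rwa [LinearIsometryEquiv.norm_map]
    _ = ‖X‖ := by ring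

theorem StarIntertwines.compression_mul_mul {V : K →L[𝕜] H} {A C : K →L[𝕜] K}
    {X Z : H →L[𝕜] H} (hX : StarIntertwines V A X) (hZ : ∀ Φ, Z (V Φ) = V (C Φ))
    (Y : H →L[𝕜] H) : compression V (X * Y * Z) = A * compression V Y * C := by
  ext Φ
  simp [compression_apply, hX.adjoint_apply, hZ]

end Intertwiners

section Extensions

variable {𝕜 K H : Type*} [RCLike 𝕜]
  [NormedAddCommGroup K] [InnerProductSpace 𝕜 K] [CompleteSpace K]
  [NormedAddCommGroup H] [InnerProductSpace 𝕜 H] [CompleteSpace H]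
  {S : StarSubalgebra 𝕜 (K →L[𝕜] K)} {T : StarSubalgebra 𝕜 (H →L[𝕜] H)} {V : K →L[𝕜] H}

/-- The star homomorphism `f` extends operators along `V`: `f A` acts on the range of `V` as `A`. -/
def IsExtension (V : K →L[𝕜] H) (f : S →⋆ₐ[𝕜] T) : Prop :=
  ∀ (A : S) (Φ : K), (f A : H →L[𝕜] H) (V Φ) = V ((A : K →L[𝕜] K) Φ)

namespace IsExtension

variable {f g : S →⋆ₐ[𝕜] T}

theorem starIntertwines (hf : IsExtension V f) (A : S) :
    StarIntertwines V (A : K →L[𝕜] K) (f A : H →L[𝕜] H) where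
  apply := hf A
  star_apply Φ := by
    have := hf (star A) Φ
    rwa [map_star] at this

theorem injective (hf : IsExtension V f) (hV : V† ∘L V = 1) : Function.Injective f :=
  fun A C h => Subtype.ext <| by
    rw [← compression_eq hV (hf A), h, compression_eq hV (hf C)]

theorem eq_of_forall_apply (hf : IsExtension V f) (hT : IsSeparating T V) (A : S)
    {X : H →L[𝕜] H} (hX : X ∈ T) (h : ∀ Φ, X (V Φ) = V ((A : K →L[𝕜] K) Φ)) : f A = X :=
  hT.eq (f A).2 hX fun Φ => (hf A Φ).trans (h Φ).symm

theorem unique (hf : IsExtension V f) (hg : IsExtension V g) (hT : IsSeparating T V) : f = g :=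
  StarAlgHom.ext fun A => Subtype.ext (hf.eq_of_forall_apply hT A (g A).2 (hg A))

end IsExtension

theorem exists_isExtension (hT : IsSeparating T V)
    (h : ∀ A ∈ S, ∃ X ∈ T, StarIntertwines V A X) : ∃ f : S →⋆ₐ[𝕜] T, IsExtension V f := by
  choose! F hFT hF using h
  have hF_eq {A : K →L[𝕜] K} (hA : A ∈ S) {X : H →L[𝕜] H} (hX : X ∈ T)
      (hXA : ∀ Φ, X (V Φ) = V (A Φ)) : F A = X :=
    hT.eq (hFT A hA) hX fun Φ => ((hF A hA).apply Φ).trans (hXA Φ).symm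
  refine ⟨
    { toFun A := ⟨F A, hFT A A.2⟩
      map_one' := Subtype.ext <| hF_eq (one_mem S) (one_mem T) fun _ => rfl
      map_mul' A C := Subtype.ext <| hF_eq (mul_mem A.2 C.2) (mul_mem (hFT A A.2) (hFT C C.2))
        ((hF A A.2).mul (hF C C.2)).apply
      map_zero' := Subtype.ext <| hF_eq (zero_mem S) (zero_mem T) fun _ => (map_zero V).symm
      map_add' A C := Subtype.ext <| hF_eq (add_mem A.2 C.2) (add_mem (hFT A A.2) (hFT C C.2))
        ((hF A A.2).add (hF C C.2)).apply
      commutes' r := Subtype.ext <| hF_eq (algebraMap_mem S r) (algebraMap_mem T r)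
        fun Φ => (map_smul V r Φ).symm
      map_star' A := Subtype.ext <| hF_eq (star_mem A.2) (star_mem (hFT A A.2))
        (hF A A.2).star_apply }, fun A => (hF A A.2).apply⟩

/-- The map `X ↦ f (V* X V)`. For an extension `f` along an isometry `V` it is the conditional
expectation of `T` onto the range of `f` that is implemented by the projection `V V*`. -/
def condExp (f : S →⋆ₐ[𝕜] T) (hVT : ∀ X ∈ T, compression V X ∈ S) : T →ₗ[𝕜] T :=
  f.toAlgHom.toLinearMap ∘ₗ
    (compression V).restrict (p := T.toSubalgebra.toSubmodule)
      (q := S.toSubalgebra.toSubmodule) hVT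

theorem condExp_apply (f : S →⋆ₐ[𝕜] T) (hVT : ∀ X ∈ T, compression V X ∈ S) (X : T) :
    condExp f hVT X = f ⟨compression V X, hVT X X.2⟩ := rfl

namespace IsExtension

variable {f : S →⋆ₐ[𝕜] T} (hf : IsExtension V f) (hVT : ∀ X ∈ T, compression V X ∈ S)
include hf

theorem condExp_apply_apply (X : T) (Φ : K) :
    (condExp f hVT X : H →L[𝕜] H) (V Φ) = (V ∘L V†) ((X : H →L[𝕜] H) (V Φ)) :=
  hf _ Φ

theorem condExp_mul_projection (X : T) :
    (condExp f hVT X : H →L[𝕜] H) * (V ∘L V†) = (V ∘L V†) * X * (V ∘L V†) := by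
  ext x
  exact hf.condExp_apply_apply hVT X ((V†) x)

theorem eq_condExp (hV : V† ∘L V = 1) (hT : IsSeparating T V) (X : T) {Y : T}
    (hY : (Y : H →L[𝕜] H) * (V ∘L V†) = (V ∘L V†) * X * (V ∘L V†)) : Y = condExp f hVT X := by
  refine Subtype.ext (hT.eq Y.2 (condExp f hVT X).2 fun Φ => ?_)
  have := DFunLike.congr_fun (hY.trans (hf.condExp_mul_projection hVT X).symm) (V Φ)
  simpa [apply_adjoint_apply hV] using this

theorem condExp_map (hV : V† ∘L V = 1) (A : S) : condExp f hVT (f A) = f A :=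
  congrArg f (Subtype.ext (compression_eq hV (hf A)))

theorem condExp_mul_mul (A C : S) (X : T) :
    condExp f hVT (f A * X * f C) = f A * condExp f hVT X * f C := by
  rw [condExp_apply, condExp_apply, ← map_mul, ← map_mul]
  exact congrArg f (Subtype.ext ((hf.starIntertwines A).compression_mul_mul (hf C) X))

end IsExtension

end Extensions

section VonNeumannExtensions

variable {K H : Type*}
  [NormedAddCommGroup K] [InnerProductSpace ℂ K] [CompleteSpace K]
  [NormedAddCommGroup H] [InnerProductSpace ℂ H] [CompleteSpace H]
  {M : VonNeumannAlgebra K} {N : VonNeumannAlgebra H} {V : K →L[ℂ] H}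
  {f : M.toStarSubalgebra →⋆ₐ[ℂ] N.toStarSubalgebra}
  (hVN : ∀ X ∈ N.toStarSubalgebra, compression V X ∈ M.toStarSubalgebra)

theorem condExp_mono : Monotone (condExp f hVN) := fun X Y h => by
  refine OrderHomClass.mono f (show compression V X ≤ compression V Y from ?_)
  rw [← sub_nonneg, ← map_sub]
  exact compression_nonneg V (sub_nonneg.2 h)

namespace IsExtension

variable (hf : IsExtension V f)
include hf

theorem isNormalMap (hN : IsSeparating N.toStarSubalgebra V) : IsNormalMap f :=
  isNormalMap_of_monotone (OrderHomClass.mono f) hN V id hf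

theorem isNormalMap_condExp (hN : IsSeparating N.toStarSubalgebra V) :
    IsNormalMap (condExp f hVN) :=
  isNormalMap_of_monotone (condExp_mono hVN) hN (V ∘L V†) V (hf.condExp_apply_apply hVN)

theorem isCondExp (hV : V† ∘L V = 1) : IsCondExp f.range (condExp f hVN) where
  range_eq := Set.Subset.antisymm
    (by rintro _ ⟨X, rfl⟩; exact ⟨_, (condExp_apply f hVN X).symm⟩)
    (by rintro _ ⟨A, rfl⟩; exact ⟨f A, hf.condExp_map hVN hV A⟩)
  map_of_mem := by rintro _ ⟨A, rfl⟩; exact hf.condExp_map hVN hV A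
  nonneg X hX := by simpa only [map_zero] using condExp_mono hVN hX
  norm_le X := (NonUnitalStarAlgHom.norm_apply_le f _).trans (norm_compression_le hV X)
  bimodule := by rintro _ ⟨A, rfl⟩ _ ⟨C, rfl⟩ X; exact hf.condExp_mul_mul hVN A C X

end IsExtension

end VonNeumannExtensions

section DoubleCones

variable {s : ℕ} {a b p q : Minkowski s}

theorem abs_sub_lt_and_norm_sub_lt_of_mem_doubleConeSet (hp : p ∈ doubleConeSet a b)
    (hq : q ∈ doubleConeSet a b) : |p.1 - q.1| < b.1 - a.1 ∧ ‖p.2 - q.2‖ < b.1 - a.1 := by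
  obtain ⟨hap, hpb⟩ : ‖p.2 - a.2‖ < p.1 - a.1 ∧ ‖b.2 - p.2‖ < b.1 - p.1 := hp
  obtain ⟨haq, hqb⟩ : ‖q.2 - a.2‖ < q.1 - a.1 ∧ ‖b.2 - q.2‖ < b.1 - q.1 := hq
  have hpq_a : ‖p.2 - q.2‖ ≤ ‖p.2 - a.2‖ + ‖q.2 - a.2‖ := by
    simpa only [dist_eq_norm] using dist_triangle_right p.2 q.2 a.2
  have hpq_b : ‖p.2 - q.2‖ ≤ ‖b.2 - p.2‖ + ‖b.2 - q.2‖ := by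
    simpa only [dist_eq_norm] using dist_triangle_left p.2 q.2 b.2
  refine ⟨abs_lt.2 ⟨?_, ?_⟩, by linarith⟩ <;>
    linarith [norm_nonneg (p.2 - a.2), norm_nonneg (b.2 - p.2), norm_nonneg (q.2 - a.2),
      norm_nonneg (b.2 - q.2)]

theorem mem_doubleConeSet_add_right (v : Minkowski s) :
    p ∈ doubleConeSet (a + v) (b + v) ↔ p - v ∈ doubleConeSet a b := by
  simp only [doubleConeSet, Set.mem_ofPred_eq, sub_sub, sub_sub_eq_add_sub, add_comm v]

theorem exists_doubleCone_subset_spacelikeComplement (hs : 1 ≤ s) (O : DoubleCone s) :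
    ∃ O₁ : DoubleCone s, (O₁ : Set (Minkowski s)) ⊆ spacelikeComplement (O : Set _) := by
  obtain ⟨_, a, b, hab, rfl⟩ := O
  have hL : 0 < b.1 - a.1 := (norm_nonneg _).trans_lt hab
  have : NeZero s := ⟨by omega⟩
  obtain ⟨v, hv⟩ := exists_norm_eq (EuclideanSpace ℝ (Fin s))
    (show 0 ≤ 2 * (b.1 - a.1) by positivity)
  let w : Minkowski s := (0, v)
  refine ⟨⟨_, a + w, b + w, by rwa [add_sub_add_right_eq_sub], rfl⟩, fun p hp q hq => ?_⟩
  obtain ⟨htime, hspace⟩ := abs_sub_lt_and_norm_sub_lt_of_mem_doubleConeSet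
    ((mem_doubleConeSet_add_right w).1 hp) hq
  have htri : ‖v‖ ≤ ‖p.2 - q.2‖ + ‖p.2 - v - q.2‖ := by
    simpa using norm_sub_le (p.2 - q.2) (p.2 - v - q.2)
  calc |p.1 - q.1| < b.1 - a.1 := by simpa [w] using htime
    _ < ‖p.2 - q.2‖ := by
      have : ‖p.2 - v - q.2‖ < b.1 - a.1 := hspace
      linarith

end DoubleCones

section Nets

variable {s : ℕ} {K H : Type*}
  [NormedAddCommGroup K] [InnerProductSpace ℂ K] [CompleteSpace K]
  [NormedAddCommGroup H] [InnerProductSpace ℂ H] [CompleteSpace H]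

namespace GradedNet

variable (F : GradedNet s H) {O : DoubleCone s} {A : H →L[ℂ] H}

theorem even_subset_twisted : F.even O ⊆ F.twisted O := fun A hA =>
  ⟨A, hA, 0, ⟨zero_mem _, by simp⟩, by simp⟩

theorem smul_k_mul_mem_twisted (hA : A ∈ F.odd O) : Complex.I • (F.k * A) ∈ F.twisted O :=
  ⟨0, ⟨zero_mem _, by simp⟩, A, hA, by simp⟩

theorem exists_even_add_odd (hA : A ∈ F.alg O) : ∃ A₀ ∈ F.even O, ∃ A₁ ∈ F.odd O, A = A₀ + A₁ := by
  have hkAk := F.k_conj O A hA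
  have hkk : F.k * (F.k * A * F.k) * F.k = A := by
    rw [mul_assoc, mul_assoc, mul_assoc, F.k_mul_k, mul_one, ← mul_assoc, F.k_mul_k, one_mul]
  refine ⟨(2⁻¹ : ℂ) • (A + F.k * A * F.k), ⟨?_, ?_⟩, (2⁻¹ : ℂ) • (A - F.k * A * F.k), ⟨?_, ?_⟩,
    by module⟩
  · exact (F.alg O).toStarSubalgebra.smul_mem (add_mem hA hkAk) _
  · rw [mul_smul_comm, smul_mul_assoc, mul_add, add_mul, hkk, add_comm]
  · exact (F.alg O).toStarSubalgebra.smul_mem (sub_mem hA hkAk) _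
  · rw [mul_smul_comm, smul_mul_assoc, mul_sub, sub_mul, hkk, ← smul_neg, neg_sub]

theorem exists_twisted_add_twisted_mul_k (hA : A ∈ F.alg O) :
    ∃ S ∈ F.twisted O, ∃ T ∈ F.twisted O, A = S + Complex.I • (T * F.k) := by
  obtain ⟨A₀, hA₀, A₁, hA₁, rfl⟩ := F.exists_even_add_odd hA
  refine ⟨A₀, F.even_subset_twisted hA₀, _, F.smul_k_mul_mem_twisted hA₁, ?_⟩
  rw [smul_mul_assoc, smul_smul, Complex.I_mul_I, hA₁.2, neg_smul, one_smul, neg_neg]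

end GradedNet

namespace NetMorphism

variable {B : GradedNet s K} {F : GradedNet s H} {V : K →L[ℂ] H}

theorem map_k_conj {φ : NetMorphism B F} (hVk : ∀ Φ, V (B.k Φ) = F.k (V Φ)) {O : DoubleCone s}
    (hφ : IsExtension V (φ.map O)) (hF : IsSeparating (F.alg O).toStarSubalgebra V)
    (A : B.Alg O) :
    (φ.map O ⟨B.k * A * B.k, B.k_conj O A A.2⟩ : H →L[ℂ] H) = F.k * φ.map O A * F.k := by
  refine hφ.eq_of_forall_apply hF _ (F.k_conj O _ (φ.map O A).2) fun Φ => ?_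
  simp only [mul_apply_eq_comp, ← hVk, hφ A]

theorem eq_of_isExtension (hF : ∀ O, IsSeparating (F.alg O).toStarSubalgebra V)
    {φ ψ : NetMorphism B F} (hφ : ∀ O, IsExtension V (φ.map O))
    (hψ : ∀ O, IsExtension V (ψ.map O)) : φ = ψ :=
  NetMorphism.ext (funext fun O => (hφ O).unique (hψ O) (hF O))

theorem exists_isExtension (hF : ∀ O, IsSeparating (F.alg O).toStarSubalgebra V)
    (h : ∀ O, ∀ A ∈ B.alg O, ∃ X ∈ F.alg O, StarIntertwines V A X) :
    ∃ φ : NetMorphism B F, ∀ O, IsExtension V (φ.map O) := by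
  choose φ hφ using fun O => GradedNets.exists_isExtension (hF O) (h O)
  exact ⟨⟨φ, fun O₁ O₂ hO A => (hφ O₂).eq_of_forall_apply (hF O₂) _
    (F.mono hO (φ O₁ A).2) (hφ O₁ A)⟩, hφ⟩

end NetMorphism

namespace NetInclusion

variable {B : GradedNet s K} {F : GradedNet s H} (i : NetInclusion B F)

theorem adjoint_comp_V : i.V.toContinuousLinearMap† ∘L i.V.toContinuousLinearMap = 1 :=
  ContinuousLinearMap.norm_map_iff_adjoint_comp_self _ |>.1 i.V.norm_map

theorem starIntertwines_k : StarIntertwines i.V.toContinuousLinearMap B.k F.k where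
  apply Φ := (i.V_k Φ).symm
  star_apply Φ := by
    rw [F.star_k, B.star_k]
    exact (i.V_k Φ).symm

theorem exists_twisted_starIntertwines {O : DoubleCone s} {T : K →L[ℂ] K} (hT : T ∈ B.twisted O) :
    ∃ T' ∈ F.twisted O, StarIntertwines i.V.toContinuousLinearMap T T' := by
  obtain ⟨A, hA, C, hC, rfl⟩ := hT
  have hι : IsExtension i.V.toContinuousLinearMap (i.ι.map O) := i.ι_apply_V O
  have k_conj := NetMorphism.map_k_conj (φ := i.ι) i.V_k hι (i.separating O)
  let A' := i.ι.map O ⟨A, hA.1⟩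
  let C' := i.ι.map O ⟨C, hC.1⟩
  have hA' : (A' : H →L[ℂ] H) ∈ F.even O :=
    ⟨A'.2, (k_conj _).symm.trans (congrArg Subtype.val (congrArg _ (Subtype.ext hA.2)))⟩
  have hC' : (C' : H →L[ℂ] H) ∈ F.odd O := by
    refine ⟨C'.2, (k_conj _).symm.trans ?_⟩
    rw [← NegMemClass.coe_neg, ← map_neg]
    exact congrArg Subtype.val (congrArg _ (Subtype.ext hC.2))
  exact ⟨_, ⟨_, hA', _, hC', rfl⟩, (hι.starIntertwines ⟨A, hA.1⟩).add
    ((i.starIntertwines_k.mul (hι.starIntertwines ⟨C, hC.1⟩)).smul _)⟩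

theorem compression_mem_dual {O : DoubleCone s} {X : H →L[ℂ] H} (hX : X ∈ F.dual.alg O) :
    compression i.V.toContinuousLinearMap X ∈ B.dual.alg O := by
  rw [GradedNet.mem_dual_alg_iff] at hX ⊢
  intro O₁ hO₁ T hT
  obtain ⟨T', hT', hTT'⟩ := i.exists_twisted_starIntertwines hT
  ext Φ
  simp only [mul_apply_eq_comp, compression_apply, ← hTT'.adjoint_apply, ← hTT'.apply]
  exact congrArg _ (DFunLike.congr_fun (hX O₁ hO₁ T' hT') _)

theorem isSeparating_dual (hs : 1 ≤ s) (O : DoubleCone s) :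
    IsSeparating (F.dual.alg O).toStarSubalgebra i.V := by
  intro X hX hXV
  obtain ⟨O₁, hO₁⟩ := exists_doubleCone_subset_spacelikeComplement hs O
  have hXT {T : H →L[ℂ] H} (hT : T ∈ F.twisted O₁) (Φ : K) : X (T (i.V Φ)) = 0 := by
    have hcomm := (F.mem_dual_alg_iff O X).1 hX O₁ hO₁ T hT
    rw [← mul_apply_eq_comp, ← hcomm, mul_apply_eq_comp, hXV, map_zero]
  have hspan : Submodule.span ℂ {x : H | ∃ A ∈ F.alg O₁, ∃ Φ : K, x = A (i.V Φ)} ≤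
      LinearMap.ker (X : H →ₗ[ℂ] H) := by
    refine Submodule.span_le.2 ?_
    rintro _ ⟨A, hA, Φ, rfl⟩
    obtain ⟨S, hS, T, hT, rfl⟩ := F.exists_twisted_add_twisted_mul_k hA
    simp [← i.V_k, hXT hS, hXT hT]
  have hker := Submodule.topologicalClosure_minimal _ hspan X.isClosed_ker
  rw [i.cyclic O₁] at hker
  exact ContinuousLinearMap.ext fun x => hker (Submodule.mem_top (x := x))

theorem mem_restrict_iff {G : GradedNet s H} {O : DoubleCone s} {A : K →L[ℂ] K} :
    A ∈ i.restrict G O ↔ ∃ X ∈ G.alg O, StarIntertwines i.V.toContinuousLinearMap A X :=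
  exists_congr fun _ => and_congr_right fun _ =>
    ⟨fun ⟨hE, h⟩ => starIntertwines_of_commute i.adjoint_comp_V hE h,
      fun h => ⟨h.commute.eq, h.apply⟩⟩

theorem dual_alg_eq_restrict_iff (O : DoubleCone s) :
    (B.dual.alg O : Set (K →L[ℂ] K)) = i.restrict F.dual O ↔ ∀ A ∈ B.dual.alg O,
      ∃ X ∈ F.dual.alg O, StarIntertwines i.V.toContinuousLinearMap A X := by
  have restrict_subset : i.restrict F.dual O ⊆ B.dual.alg O := fun A hA => by
    obtain ⟨X, hX, h⟩ := i.mem_restrict_iff.1 hA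
    rw [← compression_eq i.adjoint_comp_V h.apply]
    exact i.compression_mem_dual hX
  rw [Set.Subset.antisymm_iff, and_iff_left restrict_subset]
  exact forall₂_congr fun A _ => i.mem_restrict_iff

theorem exists_isExtension_iff_dual_alg_eq_restrict (hs : 1 ≤ s) :
    (∃ ν : NetMorphism B.dual F.dual, ∀ O, IsExtension i.V.toContinuousLinearMap (ν.map O)) ↔
      ∀ O, (B.dual.alg O : Set (K →L[ℂ] K)) = i.restrict F.dual O := by
  simp only [i.dual_alg_eq_restrict_iff]
  exact ⟨fun ⟨ν, hν⟩ O A hA => ⟨_, (ν.map O ⟨A, hA⟩).2, (hν O).starIntertwines ⟨A, hA⟩⟩,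
    NetMorphism.exists_isExtension (i.isSeparating_dual hs)⟩

theorem isNetCondExp {ν : NetMorphism B.dual F.dual}
    (hν : ∀ O, IsExtension i.V.toContinuousLinearMap (ν.map O)) :
    IsNetCondExp F.dual (fun O => (ν.map O).range)
      fun O => condExp (ν.map O) fun _ => i.compression_mem_dual where
  condExp O := (hν O).isCondExp _ i.adjoint_comp_V
  compat O₁ _ h X := ν.compat h ⟨_, i.compression_mem_dual (O := O₁) X.2⟩

end NetInclusion

end Nets

end GradedNets

end

theorem lemma3p4 {s : ℕ} (hs : 1 ≤ s) {K H : Type*}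
    [NormedAddCommGroup K] [InnerProductSpace ℂ K] [CompleteSpace K]
    [NormedAddCommGroup H] [InnerProductSpace ℂ H] [CompleteSpace H]
    (B : GradedNets.GradedNet s K) (F : GradedNets.GradedNet s H)
    (i : GradedNets.NetInclusion B F) :
    ((∃ ν : GradedNets.NetMorphism B.dual F.dual,
        ∀ O (A : B.dual.Alg O) (Φ : K),
          (ν.map O A : H →L[ℂ] H) (i.V Φ) = i.V ((A : K →L[ℂ] K) Φ)) ↔
      ∀ O, (B.dual.alg O : Set (K →L[ℂ] K)) = i.restrict F.dual O) ∧
    ∀ ν : GradedNets.NetMorphism B.dual F.dual,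
      (∀ O (A : B.dual.Alg O) (Φ : K),
        (ν.map O A : H →L[ℂ] H) (i.V Φ) = i.V ((A : K →L[ℂ] K) Φ)) →
      (∀ ν' : GradedNets.NetMorphism B.dual F.dual,
        (∀ O (A : B.dual.Alg O) (Φ : K),
          (ν'.map O A : H →L[ℂ] H) (i.V Φ) = i.V ((A : K →L[ℂ] K) Φ)) → ν' = ν) ∧
      (∀ O, Function.Injective (ν.map O)) ∧
      (∀ O, GradedNets.IsNormalMap (ν.map O)) ∧
      (∀ O (A : B.dual.Alg O),
        (ν.map O ⟨B.k * A * B.k, B.dual.k_conj O A A.2⟩ : H →L[ℂ] H) =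
          F.k * ν.map O A * F.k) ∧
      ∃! m : ∀ O, F.dual.Alg O →ₗ[ℂ] F.dual.Alg O,
        GradedNets.IsNetCondExp F.dual (fun O => (ν.map O).range) m ∧
        (∀ O, GradedNets.IsNormalMap (m O)) ∧
        ∀ O (A : F.dual.Alg O),
          (m O A : H →L[ℂ] H) * i.E = i.E * (A : H →L[ℂ] H) * i.E := by
  have hsep := i.isSeparating_dual hs
  refine ⟨i.exists_isExtension_iff_dual_alg_eq_restrict hs, fun ν hν => ?_⟩
  have hν (O : GradedNets.DoubleCone s) :
      GradedNets.IsExtension i.V.toContinuousLinearMap (ν.map O) := hν O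
  refine ⟨fun ν' hν' => GradedNets.NetMorphism.eq_of_isExtension
      (V := i.V.toContinuousLinearMap) hsep hν' hν,
    fun O => (hν O).injective i.adjoint_comp_V,
    fun O => (hν O).isNormalMap (hsep O),
    fun O => ν.map_k_conj i.V_k (hν O) (hsep O), ?_⟩
  refine ⟨_, ⟨i.isNetCondExp hν, fun O => (hν O).isNormalMap_condExp _ (hsep O),
    fun O => (hν O).condExp_mul_projection _⟩, fun m hm => ?_⟩
  exact funext fun O => LinearMap.ext fun X =>
    (hν O).eq_condExp _ i.adjoint_comp_V (hsep O) X (hm.2.2 O X)
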